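/- Let $f_\gamma:\mathbb R^n\to\mathbb R^n$, $\gamma\in\Gamma=\{1,\dots,m\}$, be continuous. A switching signal is a right-continuous, piecewise constant function $\sigma:[0,\infty)\to\Gamma$ (finitely many discontinuities in every bounded interval); its switching times are its discontinuities. A trajectory of $\dot x=f_\sigma(x)$ is a pair $(x,\sigma)$, where $\sigma$ is a switching signal and $x:\mathcal I\to\mathbb R^n$, with $\mathcal I=[0,T)$ or $[0,T]$ and $0<T\le\infty$, is a continuous, piecewise $C^1$ curve with $\dot x(t)=f_{\sigma(t)}(x(t))$ for all $t\in\mathcal I$, $t>0$, that are not switching times. It is maximal if $x$ has no proper extension to such a solution for the same $\sigma$; $\mathcal T$ is the set of maximal trajectories, and $\mathcal I_{(x,\sigma)}$ is the domain of $x$. Let $\chi=\{\chi_\gamma\}_{\gamma\in\Gamma}$ be a closed covering of $\mathbb R^n$ (each $\chi_\gamma$ is closed and $\bigcup_\gamma\chi_\gamma=\mathbb R^n$), let $\Omega\subseteq\mathbb R^n$ be open, let $V:\Omega\times\Gamma\to\mathbb R$ be continuous, and let $\tau_D>0$ and $N_0\in\{0,1,2,\dots\}$. Define the following subsets of $\mathcal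 T$. * $\mathcal T[\chi]$: those $(x,\sigma)$ with $x(t)\in\chi_{\sigma(t)}$ for all $t\in\mathcal I_{(x,\sigma)}$. * $\mathcal T_a[\tau_D,N_0]$: those $(x,\sigma)$ such that, for all $0\le a<b<\infty$, $\sigma$ has at most $N_0+(b-a)/\tau_D$ switching times in $(a,b)$. * $\mathcal T_V$: those $(x,\sigma)$ with $x(t)\in\Omega$ for all $t\in\mathcal I_{(x,\sigma)}$ and $V(x(t),\sigma(t))\ge V(x(t'),\sigma(t'))$ for all $t\le t'$ in $\mathcal I_{(x,\sigma)}$ with $\sigma(t)=\sigma(t')$. * $\mathcal T_V^*$: those $(x,\sigma)\in\mathcal T_V$ with $V(x(t),\sigma(t))=V(x(t'),\sigma(t'))$ for all $t,t'\in\mathcal I_{(x,\sigma)}$ with $\sigma(t)=\sigma(t')$. A nonempty set $M\subseteq\mathbb R^n\times\Gamma$ is weakly-invariant with respect to $\mathcal F\subseteq\mathcal T$ if for each $(\xi,\gamma)\in M$ there is $(y,\rho)\in\mathcal F$ with $y(0)=\xi$, $\rho(0)=\gamma$ and $(y(t),\rho(t))\in M$ for all $t\in\mathcal I_{(y,\rho)}$.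 **Theorem.** Let $(x,\sigma)\in\mathcal T_V\cap\mathcal T[\chi]\cap\mathcal T_a[\tau_D,N_0]$ and suppose that, for some compact $B\subset\Omega$, $x(t)$ is defined and $x(t)\in B$ for all $t\ge 0$. Then there is a largest set $M$ among the subsets of $\Omega\times\Gamma$ that are weakly-invariant with respect to $\mathcal T_V^*\cap\mathcal T[\chi]\cap\mathcal T_a[\tau_D,N_0]$, and $x(t)$ converges to $\pi_1(M)$ as $t\to\infty$, i.e. $\lim_{t\to\infty}d(x(t),\pi_1(M))=0$, where $\pi_1:\mathbb R^n\times\Gamma\to\mathbb R^n$ is the projection onto the first component and $d(\xi,A)=\inf_{\eta\in A}|\xi-\eta|$ is the Euclidean distance. -/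

import Mathlib

open Set Filter Topology

namespace Switched

/-- The switching times `t₁ < t₂ < ⋯` of `σ : [0, ∞) → Γ`: its discontinuities in `(0, ∞)`.
The index set is `Γ = Fin m` with the discrete topology.
Signals are written as functions on `ℝ`; only their values on `[0, ∞)` are ever used. -/
def switchingTimes {m : ℕ} (σ : ℝ → Fin m) : Set ℝ :=
  {t | 0 < t ∧ ¬ ContinuousAt σ t}

/-- Switching signals: right-continuous and piecewise constant on `[0, ∞)`, i.e. with finitely many
discontinuities in every bounded interval (the values being discrete, a right-continuous signal
is constant on `[s, t)` whenever there is no discontinuity in `(s, t)`). -/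
structure IsSwitchingSignal {m : ℕ} (σ : ℝ → Fin m) : Prop where
  right_continuous : ∀ t, 0 ≤ t → ContinuousWithinAt σ (Ici t) t
  piecewise_constant : ∀ b, (switchingTimes σ ∩ Iic b).Finite

/-- `σ` has average dwell-time `τD` and chatter bound `N0`. -/
def HasAverageDwellTime {m : ℕ} (τD : ℝ) (N0 : ℕ) (σ : ℝ → Fin m) : Prop :=
  ∀ a b, 0 ≤ a → a < b →
    ((switchingTimes σ ∩ Ioo a b).ncard : ℝ) ≤ (N0 : ℝ) + (b - a) / τD

/-- The possible domains of solutions: `[0, T)` with `0 < T ≤ ∞`, or `[0, T]` with `0 < T < ∞`. -/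
def IsTimeInterval (I : Set ℝ) : Prop :=
  I = Ici 0 ∨ ∃ T, 0 < T ∧ (I = Ico 0 T ∨ I = Icc 0 T)

/-- `x : I → ℝⁿ` is a solution of `x' = f(x, σ)` corresponding to `σ`: a continuous curve that
satisfies the equation at every `t ∈ I`, `t > 0`, that is not a switching time. Since every `f γ`
is continuous, such a curve is `C¹` on each closed piece between switching times, i.e. it is
piecewise smooth. (At a right endpoint in `I` the derivative is the one-sided one.) -/
structure IsSolution {n m : ℕ} (f : Fin m → EuclideanSpace ℝ (Fin n) → EuclideanSpace ℝ (Fin n))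
    (σ : ℝ → Fin m) (I : Set ℝ) (x : ℝ → EuclideanSpace ℝ (Fin n)) : Prop where
  continuousOn : ContinuousOn x I
  hasDerivWithinAt : ∀ t ∈ I, 0 < t → t ∉ switchingTimes σ →
    HasDerivWithinAt x (f (σ t) (x t)) I t

/-- A pair `(x, σ)` together with the domain of `x`. The values of `x` off `dom` and of `σ` off
`[0, ∞)` are irrelevant. -/
structure Pair (n m : ℕ) where
  x : ℝ → EuclideanSpace ℝ (Fin n)
  σ : ℝ → Fin m
  dom : Set ℝ

/-- The set of all maximal trajectories of `x' = f(x, σ)`: `σ` is a switching signal and `x` is a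
solution corresponding to `σ` that has no proper extension to a solution. -/
def maxTraj {n m : ℕ} (f : Fin m → EuclideanSpace ℝ (Fin n) → EuclideanSpace ℝ (Fin n)) :
    Set (Pair n m) :=
  {p | IsSwitchingSignal p.σ ∧ IsTimeInterval p.dom ∧ IsSolution f p.σ p.dom p.x ∧
    ∀ (J : Set ℝ) (y : ℝ → EuclideanSpace ℝ (Fin n)), IsTimeInterval J → IsSolution f p.σ J y →
      p.dom ⊆ J → EqOn y p.x p.dom → J = p.dom}

/-- A closed covering of `ℝⁿ` indexed by `Γ`. -/
structure IsClosedCovering {n m : ℕ} (χ : Fin m → Set (EuclideanSpace ℝ (Fin n))) : Prop where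
  isClosed : ∀ γ, IsClosed (χ γ)
  covers : ⋃ γ, χ γ = univ

/-- The family `T[χ]`. -/
def trajCov {n m : ℕ} (f : Fin m → EuclideanSpace ℝ (Fin n) → EuclideanSpace ℝ (Fin n))
    (χ : Fin m → Set (EuclideanSpace ℝ (Fin n))) : Set (Pair n m) :=
  {p | p ∈ maxTraj f ∧ ∀ t ∈ p.dom, p.x t ∈ χ (p.σ t)}

/-- The family `T_a[τD, N0]`. -/
def trajDwell {n m : ℕ} (f : Fin m → EuclideanSpace ℝ (Fin n) → EuclideanSpace ℝ (Fin n))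
    (τD : ℝ) (N0 : ℕ) : Set (Pair n m) :=
  {p | p ∈ maxTraj f ∧ HasAverageDwellTime τD N0 p.σ}

/-- The family `T_V`, for `V : Ω × Γ → ℝ` (only the values of `V` on `Ω × Γ` are used). -/
def trajLyap {n m : ℕ} (f : Fin m → EuclideanSpace ℝ (Fin n) → EuclideanSpace ℝ (Fin n))
    (Ω : Set (EuclideanSpace ℝ (Fin n))) (V : EuclideanSpace ℝ (Fin n) × Fin m → ℝ) :
    Set (Pair n m) :=
  {p | p ∈ maxTraj f ∧ (∀ t ∈ p.dom, p.x t ∈ Ω) ∧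
    ∀ t ∈ p.dom, ∀ t' ∈ p.dom, t ≤ t' → p.σ t = p.σ t' →
      V (p.x t', p.σ t') ≤ V (p.x t, p.σ t)}

/-- The sub-family `T_V*` of `T_V`. -/
def trajLyapStar {n m : ℕ} (f : Fin m → EuclideanSpace ℝ (Fin n) → EuclideanSpace ℝ (Fin n))
    (Ω : Set (EuclideanSpace ℝ (Fin n))) (V : EuclideanSpace ℝ (Fin n) × Fin m → ℝ) :
    Set (Pair n m) :=
  {p | p ∈ trajLyap f Ω V ∧ ∀ t ∈ p.dom, ∀ t' ∈ p.dom, p.σ t = p.σ t' →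
      V (p.x t, p.σ t) = V (p.x t', p.σ t')}

/-- A nonempty set `M ⊆ ℝⁿ × Γ` is weakly-invariant with respect to the family `F`. -/
def IsWeaklyInvariant {n m : ℕ} (F : Set (Pair n m))
    (M : Set (EuclideanSpace ℝ (Fin n) × Fin m)) : Prop :=
  M.Nonempty ∧ ∀ q ∈ M, ∃ p ∈ F, p.x 0 = q.1 ∧ p.σ 0 = q.2 ∧
    ∀ t ∈ p.dom, (p.x t, p.σ t) ∈ M

end Switched

/-! Along an ultrafilter `U` of times tending to infinity the translates `(x (s + ·), σ (s + ·))`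
converge pointwise: the states stay in the compact set `B` and there are finitely many modes.
Consider the times at which switching times of the translates accumulate along `U`. Since `U` is an
ultrafilter, *eventually* every neighbourhood of such a time contains a switch, so these times obey
the same counting bound as the switching times of `σ`; near every other time the modes are
eventually constant, so the limit state solves the limit equation there. By the mean value theorem
the equation extends to those accumulation times at which the limit mode does not jump.

The limit motion `(y, ρ)` consists of limit points of `(x, σ)` at infinity, and `V` is constant on
those lying in a fixed mode, because it decreases along `(x, σ)` within each mode. Translating `U`
translates the limit motion, hence the states of all limit motions form a weakly invariant set, and
every ultrafilter limit of `x` lies in its projection. -/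

namespace Switched

section Calculus

variable {E : Type*} [NormedAddCommGroup E] [NormedSpace ℝ E] {x x' : ℝ → E} {e : E} {t : ℝ}

theorem hasDerivWithinAt_Ici_of_eventually_hasDerivAt
    (hd : ∀ᶠ s in 𝓝[>] t, HasDerivAt x (x' s) s) (hx : ContinuousWithinAt x (Ici t) t)
    (hx' : Tendsto x' (𝓝[>] t) (𝓝 e)) : HasDerivWithinAt x e (Ici t) t :=
  hasDerivWithinAt_Ici_of_tendsto_deriv (s := Ioi t ∩ {s | HasDerivAt x (x' s) s})
    (fun _ hs ↦ hs.2.differentiableAt.differentiableWithinAt)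
    (hx.mono (inter_subset_left.trans Ioi_subset_Ici_self)) (inter_mem self_mem_nhdsWithin hd)
    (hx'.congr' (hd.mono fun _ hs ↦ hs.deriv.symm))

theorem hasDerivWithinAt_Iic_of_eventually_hasDerivAt
    (hd : ∀ᶠ s in 𝓝[<] t, HasDerivAt x (x' s) s) (hx : ContinuousWithinAt x (Iic t) t)
    (hx' : Tendsto x' (𝓝[<] t) (𝓝 e)) : HasDerivWithinAt x e (Iic t) t :=
  hasDerivWithinAt_Iic_of_tendsto_deriv (s := Iio t ∩ {s | HasDerivAt x (x' s) s})
    (fun _ hs ↦ hs.2.differentiableAt.differentiableWithinAt)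
    (hx.mono (inter_subset_left.trans Iio_subset_Iic_self)) (inter_mem self_mem_nhdsWithin hd)
    (hx'.congr' (hd.mono fun _ hs ↦ hs.deriv.symm))

theorem hasDerivAt_of_eventually_hasDerivAt_nhdsNE
    (hd : ∀ᶠ s in 𝓝[≠] t, HasDerivAt x (x' s) s) (hx : ContinuousAt x t)
    (hx' : Tendsto x' (𝓝[≠] t) (𝓝 e)) : HasDerivAt x e t := by
  rw [← nhdsLT_sup_nhdsGT, eventually_sup] at hd
  rw [← nhdsLT_sup_nhdsGT, tendsto_sup] at hx'
  simpa only [Iic_union_Ici, hasDerivWithinAt_univ] using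
    (hasDerivWithinAt_Iic_of_eventually_hasDerivAt hd.1 hx.continuousWithinAt hx'.1).union
      (hasDerivWithinAt_Ici_of_eventually_hasDerivAt hd.2 hx.continuousWithinAt hx'.2)

theorem lipschitzOnWith_of_norm_deriv_right_le {I : Set ℝ} [I.OrdConnected] {K : NNReal}
    (hx : ContinuousOn x I) (hd : ∀ t ∈ I, HasDerivWithinAt x (x' t) (Ici t) t)
    (hK : ∀ t ∈ I, ‖x' t‖ ≤ K) : LipschitzOnWith K x I := by
  refine LipschitzOnWith.of_dist_le_mul fun a ha b hb ↦ ?_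
  wlog hab : a ≤ b generalizing a b
  · rw [dist_comm, dist_comm a]
    exact this b hb a ha (le_of_not_ge hab)
  have hI : Icc a b ⊆ I := OrdConnected.out ‹_› ha hb
  have := norm_image_sub_le_of_norm_deriv_right_le_segment (hx.mono hI)
    (fun t ht ↦ hd t (hI (Ico_subset_Icc_self ht))) (fun t ht ↦ hK t (hI (Ico_subset_Icc_self ht)))
    b (right_mem_Icc.2 hab)
  rwa [dist_comm, dist_eq_norm, dist_comm, Real.dist_eq, abs_of_nonneg (sub_nonneg.2 hab)]

end Calculus

theorem eventually_nhdsNE_notMem_of_finite_inter {X : Type*} [TopologicalSpace X] [T1Space X]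
    {S W : Set X} {t : X} (hW : W ∈ 𝓝 t) (hS : (S ∩ W).Finite) : ∀ᶠ s in 𝓝[≠] t, s ∉ S := by
  filter_upwards [nhdsNE_le_cofinite t hS.compl_mem_cofinite, nhdsWithin_le_nhds hW]
    with s hs hsW hsS using hs ⟨hsS, hsW⟩

theorem finite_of_forall_finset_card_le {α : Type*} {S : Set α} {c : ℝ}
    (h : ∀ T : Finset α, ↑T ⊆ S → (T.card : ℝ) ≤ c) : S.Finite := by
  by_contra hS
  obtain ⟨k, hk⟩ := exists_nat_gt c
  obtain ⟨T, hTS, rfl⟩ := Set.Infinite.exists_subset_card_eq hS k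
  exact (h T hTS).not_gt hk

theorem tendsto_infDist_zero_of_forall_ultrafilter {ι X : Type*} [PseudoMetricSpace X]
    {l : Filter ι} {x : ι → X} {A : Set X}
    (h : ∀ U : Ultrafilter ι, ↑U ≤ l → ∃ z ∈ A, Tendsto x U (𝓝 z)) :
    Tendsto (fun i ↦ Metric.infDist (x i) A) l (𝓝 0) := by
  refine (tendsto_iff_ultrafilter _ _ _).2 fun U hU ↦ ?_
  obtain ⟨z, hzA, hz⟩ := h U hU
  exact squeeze_zero (fun _ ↦ Metric.infDist_nonneg)
    (fun _ ↦ Metric.infDist_le_dist_of_mem hzA) (tendsto_iff_dist_tendsto_zero.1 hz)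

theorem frequently_of_mapClusterPt_of_eventually_nhdsWithin {ι X : Type*} [TopologicalSpace X]
    {l : Filter ι} {w : ι → X} {z : X} {S : Set X} {P : X → Prop} (hz : MapClusterPt z l w)
    (hw : ∀ᶠ i in l, w i ∈ S) (hP : ∀ᶠ q in 𝓝[S] z, P q) : ∃ᶠ i in l, P (w i) :=
  ((hz.frequently (eventually_nhdsWithin_iff.1 hP)).and_eventually hw).mono fun _ h ↦ h.1 h.2

theorem le_of_mapClusterPt_of_antitone_on_modes {ι X Γ : Type*} [Preorder ι] [TopologicalSpace X]
    [TopologicalSpace Γ] [DiscreteTopology Γ] {V : X × Γ → ℝ} {S : Set (X × Γ)}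
    {w : ι → X × Γ} {q q' : X × Γ} (hV : ContinuousOn V S) (hwS : ∀ᶠ t in atTop, w t ∈ S)
    (hanti : ∀ᶠ t in atTop, ∀ t', t ≤ t' → (w t).2 = (w t').2 → V (w t') ≤ V (w t))
    (hqS : q ∈ S) (hqS' : q' ∈ S) (hmode : q.2 = q'.2) (hq : MapClusterPt q atTop w)
    (hq' : MapClusterPt q' atTop w) : V q ≤ V q' := by
  by_contra! hlt
  obtain ⟨c, hc', hc⟩ := exists_between hlt
  have hmode_near (p : X × Γ) : ∀ᶠ r in 𝓝[S] p, r.2 = p.2 :=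
    ((continuous_snd.tendsto p).mono_left nhdsWithin_le_nhds).eventually_mem
      (mem_nhds_discrete.2 (mem_singleton p.2))
  have hbelow := frequently_of_mapClusterPt_of_eventually_nhdsWithin hq' hwS <|
    ((hV q' hqS').eventually_lt_const hc').and (hmode_near q')
  have habove := frequently_of_mapClusterPt_of_eventually_nhdsWithin hq hwS <|
    ((hV q hqS).eventually_const_lt hc).and (hmode_near q)
  obtain ⟨t, ⟨hVt, htq'⟩, ht⟩ := (hbelow.and_eventually hanti).exists
  obtain ⟨t', ⟨hVt', ht'q⟩, htt'⟩ := (habove.and_eventually (eventually_ge_atTop t)).exists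
  exact (hVt.trans hVt').not_ge (ht t' htt' (by rw [htq', ht'q, hmode]))

section Solutions

variable {n m : ℕ} {f : Fin m → EuclideanSpace ℝ (Fin n) → EuclideanSpace ℝ (Fin n)}
  {x : ℝ → EuclideanSpace ℝ (Fin n)} {σ : ℝ → Fin m}

theorem IsTimeInterval.subset_Ici {I : Set ℝ} (hI : IsTimeInterval I) : I ⊆ Ici 0 := by
  rcases hI with rfl | ⟨T, -, rfl | rfl⟩
  exacts [subset_rfl, Ico_subset_Ici_self, Icc_subset_Ici_self]

theorem mem_maxTraj_of_isSolution_Ici (hσ : IsSwitchingSignal σ) (hx : IsSolution f σ (Ici 0) x) :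
    (⟨x, σ, Ici 0⟩ : Pair n m) ∈ maxTraj f :=
  ⟨hσ, Or.inl rfl, hx, fun _ _ hJ _ hsub _ ↦ hJ.subset_Ici.antisymm hsub⟩

theorem IsSolution.hasDerivAt (hx : IsSolution f σ (Ici 0) x) {t : ℝ} (ht : 0 < t)
    (htσ : t ∉ switchingTimes σ) : HasDerivAt x (f (σ t) (x t)) t :=
  (hx.hasDerivWithinAt t ht.le ht htσ).hasDerivAt (Ici_mem_nhds ht)

theorem IsSolution.hasDerivWithinAt_Ici (hf : ∀ γ, Continuous (f γ)) (hσ : IsSwitchingSignal σ)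
    (hx : IsSolution f σ (Ici 0) x) {t : ℝ} (ht : 0 ≤ t) :
    HasDerivWithinAt x (f (σ t) (x t)) (Ici t) t := by
  have hxt : ContinuousWithinAt x (Ici t) t := (hx.continuousOn t ht).mono (Ici_subset_Ici.2 ht)
  have hns : ∀ᶠ s in 𝓝[>] t, s ∉ switchingTimes σ :=
    nhdsGT_le_nhdsNE t
      (eventually_nhdsNE_notMem_of_finite_inter (Iic_mem_nhds (lt_add_one t))
        (hσ.piecewise_constant (t + 1)))
  refine hasDerivWithinAt_Ici_of_eventually_hasDerivAt (x' := fun s ↦ f (σ s) (x s)) ?_ hxt ?_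
  · filter_upwards [hns, self_mem_nhdsWithin] with s hs hts using hx.hasDerivAt (ht.trans_lt hts) hs
  · have hfc : Continuous fun q : Fin m × EuclideanSpace ℝ (Fin n) ↦ f q.1 q.2 :=
      continuous_prod_of_discrete_left.2 hf
    exact (hfc.tendsto (σ t, x t)).comp
      (((hσ.right_continuous t ht).prodMk_nhds hxt).mono_left
        (nhdsWithin_mono t Ioi_subset_Ici_self))

theorem IsSolution.uniformContinuousOn_of_mem_isCompact (hf : ∀ γ, Continuous (f γ))
    (hσ : IsSwitchingSignal σ) (hx : IsSolution f σ (Ici 0) x)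
    {B : Set (EuclideanSpace ℝ (Fin n))} (hB : IsCompact B) (hxB : ∀ t, 0 ≤ t → x t ∈ B) :
    UniformContinuousOn x (Ici 0) := by
  obtain ⟨C, hC⟩ := (isCompact_univ.prod hB).exists_bound_of_continuousOn
    (f := fun q ↦ f q.1 q.2) (continuous_prod_of_discrete_left.2 hf).continuousOn
  exact (lipschitzOnWith_of_norm_deriv_right_le (K := C.toNNReal) hx.continuousOn
    (fun t ht ↦ hx.hasDerivWithinAt_Ici hf hσ ht)
    fun t ht ↦ (hC (σ t, x t) ⟨mem_univ _, hxB t ht⟩).trans C.le_coe_toNNReal).uniformContinuousOn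

end Solutions

section LimitSwitchingTimes

variable {m : ℕ} {σ : ℝ → Fin m} {κ : ℝ → ℝ} {t : ℝ}

/-- `σ` has at most `κ ℓ` switching times in every open interval of length `ℓ`. Average dwell-time
is the case `κ ℓ = N0 + ℓ / τD`. -/
def HasSwitchingBound (κ : ℝ → ℝ) (σ : ℝ → Fin m) : Prop :=
  ∀ a b, 0 ≤ a → a < b → ((switchingTimes σ ∩ Ioo a b).ncard : ℝ) ≤ κ (b - a)

/-- The times at which switching times of the translates `σ (s + ·)` accumulate along `s → U`. They
contain the discontinuities of every limit of these translates, and possibly further times, around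
which `σ (s + ·)` leaves a mode for a vanishingly short time and then returns to it. -/
def limitSwitchingTimes (σ : ℝ → Fin m) (U : Filter ℝ) : Set ℝ :=
  {t | ∃ᶠ p in U ×ˢ 𝓝 t, p.1 + p.2 ∈ switchingTimes σ}

theorem eventually_exists_mem_switchingTimes {U : Ultrafilter ℝ}
    (ht : t ∈ limitSwitchingTimes σ U) {W : Set ℝ} (hW : W ∈ 𝓝 t) :
    ∀ᶠ s in U, ∃ r ∈ W, s + r ∈ switchingTimes σ := by
  refine Frequently.eventually fun hno ↦ ht ?_
  filter_upwards [hno.prod_mk (eventually_mem_set.2 hW)] with p hp hpσ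
  exact hp.1 ⟨p.2, hp.2, hpσ⟩

theorem tendsto_add_prod_nhds_atTop {U : Filter ℝ} (hU : U ≤ atTop) (t : ℝ) :
    Tendsto (fun p : ℝ × ℝ ↦ p.1 + p.2) (U ×ˢ 𝓝 t) atTop :=
  (tendsto_fst.mono_right hU).atTop_add tendsto_snd

theorem exists_mem_nhds_eventually_constant {U : Filter ℝ} (hU : U ≤ atTop)
    (ht : t ∉ limitSwitchingTimes σ U) :
    ∃ W ∈ 𝓝 t, ∀ᶠ s in U, ∀ r ∈ W, ∀ r' ∈ W, σ (s + r) = σ (s + r') := by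
  obtain ⟨P, hP, Q, hQ, hPQ⟩ := eventually_prod_iff.1 <| (not_frequently.1 ht).and <|
    (tendsto_add_prod_nhds_atTop hU t).eventually_gt_atTop 0
  obtain ⟨δ, hδ, hball⟩ := Metric.eventually_nhds_iff_ball.1 hQ
  refine ⟨Metric.ball t δ, Metric.ball_mem_nhds t hδ, hP.mono fun s hs r hr r' hr' ↦ ?_⟩
  have hcont : ContinuousOn (fun r ↦ σ (s + r)) (Metric.ball t δ) := fun r hr ↦ by
    obtain ⟨hns, hpos⟩ := hPQ hs (hball r hr)
    have hσ : ContinuousAt σ (s + r) := not_not.1 fun h ↦ hns ⟨hpos, h⟩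
    exact (hσ.comp (f := fun r ↦ s + r) (by fun_prop)).continuousWithinAt
  exact (convex_ball t δ).isPreconnected.constant hcont hr hr'

variable {U : Ultrafilter ℝ}

theorem HasSwitchingBound.card_le_of_subset_limitSwitchingTimes (hκ : HasSwitchingBound κ σ)
    (hσ : IsSwitchingSignal σ) (hU : (U : Filter ℝ) ≤ atTop) {a b : ℝ} (hab : a < b) {T : Finset ℝ}
    (hT : ↑T ⊆ limitSwitchingTimes σ U ∩ Ioo a b) : (T.card : ℝ) ≤ κ (b - a) := by
  obtain ⟨W, hW, hWdisj⟩ := T.finite_toSet.t2_separation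
  have hswitch : ∀ᶠ s in U, ∀ t ∈ T, ∃ r ∈ W t ∩ Ioo a b, s + r ∈ switchingTimes σ :=
    (eventually_all_finset T).2 fun t ht ↦ eventually_exists_mem_switchingTimes (hT ht).1 <|
      inter_mem ((hW t).2.mem_nhds (hW t).1) (Ioo_mem_nhds (hT ht).2.1 (hT ht).2.2)
  obtain ⟨s, hs, hsa⟩ := (hswitch.and (hU (eventually_ge_atTop (-a)))).exists
  choose! r hrW hrσ using hs
  have hinj : InjOn (fun t ↦ s + r t) T := fun t ht t' ht' hrr ↦ by
    by_contra hne
    exact disjoint_left.1 (hWdisj ht ht' hne) (hrW t ht).1 (add_left_cancel hrr ▸ (hrW t' ht').1)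
  have hmaps : ∀ t ∈ (T : Set ℝ), s + r t ∈ switchingTimes σ ∩ Ioo (s + a) (s + b) := fun t ht ↦
    ⟨hrσ t ht, add_lt_add_right (hrW t ht).2.1 s, add_lt_add_right (hrW t ht).2.2 s⟩
  have hfin : (switchingTimes σ ∩ Ioo (s + a) (s + b)).Finite :=
    (hσ.piecewise_constant (s + b)).subset (inter_subset_inter_right _ fun _ h ↦ h.2.le)
  calc (T.card : ℝ) ≤ (switchingTimes σ ∩ Ioo (s + a) (s + b)).ncard := by
        rw [← ncard_coe_finset]
        exact_mod_cast ncard_le_ncard_of_injOn _ hmaps hinj hfin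
    _ ≤ κ (s + b - (s + a)) := hκ _ _ (by linarith) (by linarith)
    _ = κ (b - a) := by rw [add_sub_add_left_eq_sub]

theorem HasSwitchingBound.finite_limitSwitchingTimes_inter_Ioo (hκ : HasSwitchingBound κ σ)
    (hσ : IsSwitchingSignal σ) (hU : (U : Filter ℝ) ≤ atTop) (a b : ℝ) :
    (limitSwitchingTimes σ U ∩ Ioo a b).Finite := by
  rcases lt_or_ge a b with hab | hba
  · exact finite_of_forall_finset_card_le fun T hT ↦
      hκ.card_le_of_subset_limitSwitchingTimes hσ hU hab hT
  · simp [Ioo_eq_empty_of_le hba]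

theorem HasSwitchingBound.ncard_limitSwitchingTimes_inter_Ioo_le (hκ : HasSwitchingBound κ σ)
    (hσ : IsSwitchingSignal σ) (hU : (U : Filter ℝ) ≤ atTop) {a b : ℝ} (hab : a < b) :
    ((limitSwitchingTimes σ U ∩ Ioo a b).ncard : ℝ) ≤ κ (b - a) := by
  have hfin := hκ.finite_limitSwitchingTimes_inter_Ioo hσ hU a b
  rw [ncard_eq_toFinset_card _ hfin]
  exact hκ.card_le_of_subset_limitSwitchingTimes hσ hU hab (by simp)

theorem HasSwitchingBound.eventually_notMem_limitSwitchingTimes (hκ : HasSwitchingBound κ σ)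
    (hσ : IsSwitchingSignal σ) (hU : (U : Filter ℝ) ≤ atTop) (t : ℝ) :
    ∀ᶠ s in 𝓝[≠] t, s ∉ limitSwitchingTimes σ U :=
  eventually_nhdsNE_notMem_of_finite_inter (Ioo_mem_nhds (sub_one_lt t) (lt_add_one t))
    (hκ.finite_limitSwitchingTimes_inter_Ioo hσ hU _ _)

theorem HasSwitchingBound.exists_right_limit_mode (hκ : HasSwitchingBound κ σ)
    (hσ : IsSwitchingSignal σ) (hU : (U : Filter ℝ) ≤ atTop) (t : ℝ) :
    ∃ γ, ∀ᶠ r in 𝓝[>] t, ∀ᶠ s in U, σ (s + r) = γ := by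
  have hpt : ∀ r, ∃ γ, ∀ᶠ s in U, σ (s + r) = γ := fun r ↦
    Ultrafilter.eventually_exists_iff.1 (Eventually.of_forall fun s ↦ ⟨σ (s + r), rfl⟩)
  choose ρ₀ hρ₀ using hpt
  obtain ⟨u, htu, hu⟩ := mem_nhdsGT_iff_exists_Ioo_subset.1
    (nhdsGT_le_nhdsNE t (hκ.eventually_notMem_limitSwitchingTimes hσ hU t))
  have hcont : ContinuousOn ρ₀ (Ioo t u) := fun r hr ↦ by
    obtain ⟨W, hW, hWσ⟩ := exists_mem_nhds_eventually_constant hU (hu hr)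
    refine ContinuousAt.continuousWithinAt (tendsto_nhds_of_eventually_eq ?_)
    filter_upwards [hW] with r' hr'
    obtain ⟨s, hs, hsr, hsr'⟩ := (hWσ.and ((hρ₀ r).and (hρ₀ r'))).exists
    rw [← hsr, ← hsr', hs r' hr' r (mem_of_mem_nhds hW)]
  obtain ⟨c, hc⟩ := nonempty_Ioo.2 (mem_Ioi.1 htu)
  refine ⟨ρ₀ c, ?_⟩
  filter_upwards [Ioo_mem_nhdsGT htu] with r hr
  rw [← isPreconnected_Ioo.constant hcont hr hc]
  exact hρ₀ r

end LimitSwitchingTimes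

section LimitMotion

variable {n m : ℕ} {f : Fin m → EuclideanSpace ℝ (Fin n) → EuclideanSpace ℝ (Fin n)}
  {x y : ℝ → EuclideanSpace ℝ (Fin n)} {σ ρ : ℝ → Fin m} {U : Ultrafilter ℝ} {κ : ℝ → ℝ} {t : ℝ}

/-- `(y, ρ)` is the limit of the translates `(x (s + ·), σ (s + ·))` as `s → ∞` along `U`: `y` is
their pointwise limit, while `ρ`, in order to be right-continuous, is the right limit of the
pointwise limit of the modes. -/
structure IsLimitMotion (x : ℝ → EuclideanSpace ℝ (Fin n)) (σ : ℝ → Fin m) (U : Ultrafilter ℝ)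
    (y : ℝ → EuclideanSpace ℝ (Fin n)) (ρ : ℝ → Fin m) : Prop where
  le_atTop : ↑U ≤ (atTop : Filter ℝ)
  tendsto : ∀ t, Tendsto (fun s ↦ x (s + t)) U (𝓝 (y t))
  eventually_mode : ∀ t, ∀ᶠ r in 𝓝[>] t, ∀ᶠ s in U, σ (s + r) = ρ t

theorem HasSwitchingBound.exists_isLimitMotion (hκ : HasSwitchingBound κ σ)
    (hσ : IsSwitchingSignal σ) {B : Set (EuclideanSpace ℝ (Fin n))} (hB : IsCompact B)
    (hxB : ∀ᶠ t in atTop, x t ∈ B) (hU : (U : Filter ℝ) ≤ atTop) :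
    ∃ y ρ, IsLimitMotion x σ U y ρ := by
  have hstate : ∀ t, ∃ z, Tendsto (fun s ↦ x (s + t)) U (𝓝 z) := fun t ↦ by
    have hmem : ∀ᶠ s in U, x (s + t) ∈ B :=
      hU ((tendsto_atTop_add_const_right _ t tendsto_id).eventually hxB)
    obtain ⟨z, -, hz⟩ :=
      hB.ultrafilter_le_nhds (U.map fun s ↦ x (s + t)) (le_principal_iff.2 hmem)
    exact ⟨z, hz⟩
  choose y hy using hstate
  choose ρ hρ using hκ.exists_right_limit_mode hσ hU
  exact ⟨y, ρ, hU, hy, hρ⟩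

namespace IsLimitMotion

theorem comp_add_left (h : IsLimitMotion x σ U y ρ) (c : ℝ) :
    IsLimitMotion x σ (U.map (· + c)) (fun t ↦ y (c + t)) (fun t ↦ ρ (c + t)) where
  le_atTop := (tendsto_atTop_add_const_right _ c tendsto_id).mono_left h.le_atTop
  tendsto t := tendsto_map'_iff.2 <| by
    simpa only [Function.comp_def, add_assoc] using h.tendsto (c + t)
  eventually_mode t := by
    have hshift : Tendsto (c + ·) (𝓝[>] t) (𝓝[>] (c + t)) :=
      tendsto_nhdsWithin_iff.2 ⟨(Continuous.tendsto (by fun_prop) t).mono_left nhdsWithin_le_nhds,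
        eventually_mem_nhdsWithin.mono fun r hr ↦ add_lt_add_right hr c⟩
    filter_upwards [hshift.eventually (h.eventually_mode (c + t))] with r hr
    simpa only [Ultrafilter.coe_map, eventually_map, add_assoc] using hr

theorem mode_eq_of_eventually (h : IsLimitMotion x σ U y ρ) {γ : Fin m}
    (hγ : ∀ᶠ r in 𝓝[>] t, ∀ᶠ s in U, σ (s + r) = γ) : ρ t = γ := by
  obtain ⟨r, hr⟩ := (hγ.and (h.eventually_mode t)).exists
  obtain ⟨s, hsγ, hsρ⟩ := (hr.1.and hr.2).exists
  exact hsρ.symm.trans hsγ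

theorem continuousWithinAt_mode (h : IsLimitMotion x σ U y ρ) (t : ℝ) :
    ContinuousWithinAt ρ (Ici t) t := by
  rw [← continuousWithinAt_Ioi_iff_Ici]
  refine tendsto_nhds_of_eventually_eq ?_
  filter_upwards [eventually_eventually_nhdsWithin.2 (h.eventually_mode t), self_mem_nhdsWithin]
    with s hs hts
  exact h.mode_eq_of_eventually (hs.filter_mono (nhdsWithin_mono s (Ioi_subset_Ioi (le_of_lt hts))))

theorem eventually_prod_mode (h : IsLimitMotion x σ U y ρ) (ht : t ∉ limitSwitchingTimes σ U) :
    ∀ᶠ p in ↑U ×ˢ 𝓝 t, σ (p.1 + p.2) = ρ t := by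
  obtain ⟨W, hW, hWσ⟩ := exists_mem_nhds_eventually_constant h.le_atTop ht
  obtain ⟨r, hr, hrW⟩ := ((h.eventually_mode t).and (nhdsWithin_le_nhds hW)).exists
  filter_upwards [(hWσ.and hr).prod_mk (eventually_mem_set.2 hW)] with p hp
  rw [hp.1.1 p.2 hp.2 r hrW, hp.1.2]

theorem continuousAt_mode (h : IsLimitMotion x σ U y ρ) (ht : t ∉ limitSwitchingTimes σ U) :
    ContinuousAt ρ t := by
  have hmode : ∀ᶠ r in 𝓝 t, ∀ᶠ s in U, σ (s + r) = ρ t :=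
    (eventually_swap_iff.1 (h.eventually_prod_mode ht)).curry
  refine tendsto_nhds_of_eventually_eq ?_
  filter_upwards [eventually_eventually_nhds.2 hmode] with r hr
  exact h.mode_eq_of_eventually (hr.filter_mono nhdsWithin_le_nhds)

theorem switchingTimes_subset (h : IsLimitMotion x σ U y ρ) :
    switchingTimes ρ ⊆ limitSwitchingTimes σ U :=
  fun _ ht ↦ not_not.1 fun htσ ↦ ht.2 (h.continuousAt_mode htσ)

theorem isSwitchingSignal (h : IsLimitMotion x σ U y ρ) (hσ : IsSwitchingSignal σ)
    (hκ : HasSwitchingBound κ σ) : IsSwitchingSignal ρ where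
  right_continuous t _ := h.continuousWithinAt_mode t
  piecewise_constant b := (hκ.finite_limitSwitchingTimes_inter_Ioo hσ h.le_atTop 0 (b + 1)).subset
    fun _ ht ↦ ⟨h.switchingTimes_subset ht.1, ht.1.1, lt_add_of_le_of_pos ht.2 one_pos⟩

theorem hasSwitchingBound (h : IsLimitMotion x σ U y ρ) (hσ : IsSwitchingSignal σ)
    (hκ : HasSwitchingBound κ σ) : HasSwitchingBound κ ρ := fun a b _ hab ↦
  (Nat.cast_le.2 (ncard_le_ncard (inter_subset_inter_left _ h.switchingTimes_subset)
    (hκ.finite_limitSwitchingTimes_inter_Ioo hσ h.le_atTop a b))).trans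
      (hκ.ncard_limitSwitchingTimes_inter_Ioo_le hσ h.le_atTop hab)

theorem tendsto_prod (h : IsLimitMotion x σ U y ρ) (hx : UniformContinuousOn x (Ici 0)) (t : ℝ) :
    Tendsto (fun p : ℝ × ℝ ↦ x (p.1 + p.2)) (↑U ×ˢ 𝓝 t) (𝓝 (y t)) := by
  refine ((h.tendsto t).comp tendsto_fst).congr_dist (Metric.tendsto_nhds.2 fun ε hε ↦ ?_)
  obtain ⟨δ, hδ, hxδ⟩ := Metric.uniformContinuousOn_iff.1 hx ε hε
  have hU : ∀ᶠ s in U, 0 ≤ s + t :=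
    h.le_atTop ((tendsto_atTop_add_const_right _ t tendsto_id).eventually_ge_atTop 0)
  filter_upwards [hU.prod_mk (Metric.ball_mem_nhds t hδ),
    (tendsto_add_prod_nhds_atTop h.le_atTop t).eventually_ge_atTop 0] with p hp hp0
  have hδp : dist (p.1 + t) (p.1 + p.2) < δ := by
    rw [dist_add_left, dist_comm]
    exact hp.2
  simpa using hxδ _ hp.1 _ hp0 hδp

theorem continuous (h : IsLimitMotion x σ U y ρ) (hx : UniformContinuousOn x (Ici 0)) :
    Continuous y := by
  refine continuous_iff_continuousAt.2 fun t ↦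
    Metric.nhds_basis_closedBall.tendsto_right_iff.2 fun ε hε ↦ ?_
  have hnear : ∀ᶠ r in 𝓝 t, ∀ᶠ s in U, x (s + r) ∈ Metric.closedBall (y t) ε :=
    (eventually_swap_iff.1 ((h.tendsto_prod hx t) (Metric.closedBall_mem_nhds _ hε))).curry
  filter_upwards [hnear] with r hr using Metric.isClosed_closedBall.mem_of_tendsto (h.tendsto r) hr

theorem hasDerivAt (h : IsLimitMotion x σ U y ρ) (hf : ∀ γ, Continuous (f γ))
    (hx : IsSolution f σ (Ici 0) x) (hxu : UniformContinuousOn x (Ici 0))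
    (ht : t ∉ limitSwitchingTimes σ U) : HasDerivAt y (f (ρ t) (y t)) t := by
  refine hasDerivAt_of_tendstoUniformlyOnFilter (l := ↑U) (f := fun s r ↦ x (s + r))
    (f' := fun s r ↦ f (ρ t) (x (s + r))) (g' := fun _ ↦ f (ρ t) (y t))
    (tendsto_prod_filter_iff.1 (((hf (ρ t)).tendsto (y t)).comp (h.tendsto_prod hxu t))) ?_
    (Eventually.of_forall h.tendsto)
  filter_upwards [h.eventually_prod_mode ht, not_frequently.1 ht,
    (tendsto_add_prod_nhds_atTop h.le_atTop t).eventually_gt_atTop 0] with p hmode hns hpos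
  rw [← hmode]
  exact (hx.hasDerivAt hpos hns).comp_const_add p.1 p.2

theorem isSolution (h : IsLimitMotion x σ U y ρ) (hf : ∀ γ, Continuous (f γ))
    (hσ : IsSwitchingSignal σ) (hκ : HasSwitchingBound κ σ) (hx : IsSolution f σ (Ici 0) x)
    (hxu : UniformContinuousOn x (Ici 0)) : IsSolution f ρ (Ici 0) y where
  continuousOn := (h.continuous hxu).continuousOn
  hasDerivWithinAt t _ ht htρ := by
    have hρt : ContinuousAt ρ t := not_not.1 fun hc ↦ htρ ⟨ht, hc⟩
    have hyt : ContinuousAt y t := (h.continuous hxu).continuousAt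
    have hfc : Continuous fun q : Fin m × EuclideanSpace ℝ (Fin n) ↦ f q.1 q.2 :=
      continuous_prod_of_discrete_left.2 hf
    have hder : ∀ᶠ s in 𝓝[≠] t, HasDerivAt y (f (ρ s) (y s)) s :=
      (hκ.eventually_notMem_limitSwitchingTimes hσ h.le_atTop t).mono fun s hs ↦
        h.hasDerivAt hf hx hxu hs
    -- A limit switching time at which `ρ` is continuous is a removable singularity.
    exact (hasDerivAt_of_eventually_hasDerivAt_nhdsNE hder hyt
      (((hfc.tendsto (ρ t, y t)).comp (hρt.prodMk_nhds hyt)).mono_left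
        nhdsWithin_le_nhds)).hasDerivWithinAt

theorem mapClusterPt (h : IsLimitMotion x σ U y ρ) (hx : UniformContinuousOn x (Ici 0)) (t : ℝ) :
    MapClusterPt (y t, ρ t) atTop (fun s ↦ (x s, σ s)) := by
  have hy : Tendsto (fun r ↦ (y r, ρ t)) (𝓝[>] t) (𝓝 (y t, ρ t)) :=
    (((h.continuous hx).tendsto t).mono_left nhdsWithin_le_nhds).prodMk_nhds tendsto_const_nhds
  refine isClosed_setOfPred_clusterPt.mem_of_tendsto hy ?_
  filter_upwards [h.eventually_mode t] with r hr
  have hlim : Tendsto (fun s ↦ (x (s + r), σ (s + r))) U (𝓝 (y r, ρ t)) :=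
    (h.tendsto r).prodMk_nhds (tendsto_nhds_of_eventually_eq hr)
  exact hlim.mapClusterPt.of_comp (φ := (· + r))
    ((tendsto_atTop_add_const_right _ r tendsto_id).mono_left h.le_atTop)

end IsLimitMotion

end LimitMotion

section Invariance

variable {n m : ℕ} {f : Fin m → EuclideanSpace ℝ (Fin n) → EuclideanSpace ℝ (Fin n)}
  {χ : Fin m → Set (EuclideanSpace ℝ (Fin n))} {Ω B : Set (EuclideanSpace ℝ (Fin n))}
  {V : EuclideanSpace ℝ (Fin n) × Fin m → ℝ} {κ : ℝ → ℝ}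
  {x y : ℝ → EuclideanSpace ℝ (Fin n)} {σ ρ : ℝ → Fin m} {U : Ultrafilter ℝ}

/-- The family of maximal trajectories with at most `κ ℓ` switching times in every open interval of
length `ℓ`, which generalizes `trajDwell`. -/
def trajSwitchingBound (f : Fin m → EuclideanSpace ℝ (Fin n) → EuclideanSpace ℝ (Fin n))
    (κ : ℝ → ℝ) : Set (Pair n m) :=
  {p | p ∈ maxTraj f ∧ HasSwitchingBound κ p.σ}

namespace IsLimitMotion

theorem mem_of_isClosed (h : IsLimitMotion x σ U y ρ) (hxu : UniformContinuousOn x (Ici 0))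
    {K : Set (EuclideanSpace ℝ (Fin n) × Fin m)} (hK : IsClosed K)
    (hxK : ∀ t, 0 ≤ t → (x t, σ t) ∈ K) (t : ℝ) : (y t, ρ t) ∈ K :=
  hK.mem_of_mapClusterPt (h.mapClusterPt hxu t) ((eventually_ge_atTop 0).mono hxK)

theorem mem_trajSwitchingBound (h : IsLimitMotion x σ U y ρ) (hf : ∀ γ, Continuous (f γ))
    (hxu : UniformContinuousOn x (Ici 0)) (hp : ⟨x, σ, Ici 0⟩ ∈ trajSwitchingBound f κ) :
    ⟨y, ρ, Ici 0⟩ ∈ trajSwitchingBound f κ := by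
  obtain ⟨⟨hσ, -, hx, -⟩, hκ⟩ := hp
  exact ⟨mem_maxTraj_of_isSolution_Ici (h.isSwitchingSignal hσ hκ) (h.isSolution hf hσ hκ hx hxu),
    h.hasSwitchingBound hσ hκ⟩

theorem mem_trajCov (h : IsLimitMotion x σ U y ρ) (hxu : UniformContinuousOn x (Ici 0))
    (hχ : ∀ γ, IsClosed (χ γ)) (hp : ⟨x, σ, Ici 0⟩ ∈ trajCov f χ)
    (hy : ⟨y, ρ, Ici 0⟩ ∈ maxTraj f) : ⟨y, ρ, Ici 0⟩ ∈ trajCov f χ := by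
  have hgraph : IsClosed (⋃ γ, χ γ ×ˢ {γ}) :=
    isClosed_iUnion_of_finite fun γ ↦ (hχ γ).prod isClosed_singleton
  refine ⟨hy, fun t _ ↦ ?_⟩
  simpa using h.mem_of_isClosed hxu hgraph (fun t ht ↦ by simpa using hp.2 t ht) t

theorem mem_trajLyapStar (h : IsLimitMotion x σ U y ρ) (hxu : UniformContinuousOn x (Ici 0))
    (hV : ContinuousOn V (Ω ×ˢ univ)) (hB : IsClosed B) (hBΩ : B ⊆ Ω)
    (hxB : ∀ t, 0 ≤ t → x t ∈ B) (hp : ⟨x, σ, Ici 0⟩ ∈ trajLyap f Ω V)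
    (hy : ⟨y, ρ, Ici 0⟩ ∈ maxTraj f) : ⟨y, ρ, Ici 0⟩ ∈ trajLyapStar f Ω V := by
  have hyΩ : ∀ t, y t ∈ Ω := fun t ↦
    hBΩ (h.mem_of_isClosed hxu (hB.preimage continuous_fst) hxB t)
  have hxΩ : ∀ᶠ s in atTop, (x s, σ s) ∈ Ω ×ˢ univ :=
    (eventually_ge_atTop 0).mono fun s hs ↦ ⟨hp.2.1 s hs, mem_univ _⟩
  have hanti : ∀ᶠ s in atTop, ∀ s', s ≤ s' → σ s = σ s' → V (x s', σ s') ≤ V (x s, σ s) :=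
    (eventually_ge_atTop 0).mono fun s hs s' hss' ↦ hp.2.2 s hs s' (le_trans hs hss') hss'
  have hle : ∀ t t', ρ t = ρ t' → V (y t, ρ t) ≤ V (y t', ρ t') := fun t t' hρ ↦
    le_of_mapClusterPt_of_antitone_on_modes hV hxΩ hanti ⟨hyΩ t, mem_univ _⟩
      ⟨hyΩ t', mem_univ _⟩ hρ (h.mapClusterPt hxu t) (h.mapClusterPt hxu t')
  exact ⟨⟨hy, fun t _ ↦ hyΩ t, fun t _ t' _ _ hρ ↦ hle t' t hρ.symm⟩,
    fun t _ t' _ hρ ↦ (hle t t' hρ).antisymm (hle t' t hρ.symm)⟩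

end IsLimitMotion

/-- The initial states `(y 0, ρ 0)` of all limit motions of `(x, σ)`. Since limit motions may be
translated in time, these are all the states that limit motions pass through. -/
def limitMotionStates (x : ℝ → EuclideanSpace ℝ (Fin n)) (σ : ℝ → Fin m) :
    Set (EuclideanSpace ℝ (Fin n) × Fin m) :=
  {q | ∃ U y ρ, IsLimitMotion x σ U y ρ ∧ q = (y 0, ρ 0)}

theorem limitMotionStates_nonempty
    (hlim : ∀ U : Ultrafilter ℝ, ↑U ≤ (atTop : Filter ℝ) → ∃ y ρ, IsLimitMotion x σ U y ρ) :
    (limitMotionStates x σ).Nonempty := by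
  obtain ⟨y, ρ, h⟩ := hlim (Ultrafilter.of atTop) (Ultrafilter.of_le _)
  exact ⟨_, _, y, ρ, h, rfl⟩

theorem isWeaklyInvariant_limitMotionStates {F : Set (Pair n m)}
    (hne : (limitMotionStates x σ).Nonempty)
    (hF : ∀ U y ρ, IsLimitMotion x σ U y ρ → ⟨y, ρ, Ici 0⟩ ∈ F) :
    IsWeaklyInvariant F (limitMotionStates x σ) := by
  refine ⟨hne, ?_⟩
  rintro _ ⟨U, y, ρ, h, rfl⟩
  exact ⟨_, hF U y ρ h, rfl, rfl, fun t _ ↦ ⟨_, _, _, h.comp_add_left t, by simp only [add_zero]⟩⟩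

theorem tendsto_infDist_of_limitMotionStates_subset
    (hlim : ∀ U : Ultrafilter ℝ, ↑U ≤ (atTop : Filter ℝ) → ∃ y ρ, IsLimitMotion x σ U y ρ)
    {M : Set (EuclideanSpace ℝ (Fin n) × Fin m)} (hM : limitMotionStates x σ ⊆ M) :
    Tendsto (fun t ↦ Metric.infDist (x t) (Prod.fst '' M)) atTop (𝓝 0) := by
  refine tendsto_infDist_zero_of_forall_ultrafilter fun U hU ↦ ?_
  obtain ⟨y, ρ, h⟩ := hlim U hU
  exact ⟨y 0, mem_image_of_mem Prod.fst (hM ⟨U, y, ρ, h, rfl⟩),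
    by simpa only [add_zero] using h.tendsto 0⟩

theorem isGreatest_sUnion_isWeaklyInvariant {F : Set (Pair n m)}
    {S : Set (EuclideanSpace ℝ (Fin n) × Fin m)} (hne : ∃ M, IsWeaklyInvariant F M ∧ M ⊆ S) :
    IsGreatest {M | IsWeaklyInvariant F M ∧ M ⊆ S} (⋃₀ {M | IsWeaklyInvariant F M ∧ M ⊆ S}) := by
  refine ⟨⟨⟨?_, ?_⟩, sUnion_subset fun M hM ↦ hM.2⟩, fun M hM ↦ subset_sUnion_of_mem hM⟩
  · obtain ⟨M, hM⟩ := hne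
    exact hM.1.1.mono (subset_sUnion_of_mem hM)
  · rintro q ⟨M, hM, hq⟩
    obtain ⟨p, hp, hpx, hpσ, hpM⟩ := hM.1.2 q hq
    exact ⟨p, hp, hpx, hpσ, fun t ht ↦ ⟨M, hM, hpM t ht⟩⟩

end Invariance

end Switched

theorem theorem4_general {n m : ℕ}
    (f : Fin m → EuclideanSpace ℝ (Fin n) → EuclideanSpace ℝ (Fin n))
    (hf : ∀ γ, Continuous (f γ))
    (χ : Fin m → Set (EuclideanSpace ℝ (Fin n))) (hχ : ∀ γ, IsClosed (χ γ))
    (Ω : Set (EuclideanSpace ℝ (Fin n)))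
    (V : EuclideanSpace ℝ (Fin n) × Fin m → ℝ) (hV : ContinuousOn V (Ω ×ˢ univ))
    (κ : ℝ → ℝ) (p : Switched.Pair n m)
    (hp : p ∈ Switched.trajLyap f Ω V ∩ Switched.trajCov f χ ∩ Switched.trajSwitchingBound f κ)
    (B : Set (EuclideanSpace ℝ (Fin n))) (hB : IsCompact B) (hBΩ : B ⊆ Ω)
    (hpB : ∀ t, 0 ≤ t → t ∈ p.dom ∧ p.x t ∈ B) :
    ∃ M : Set (EuclideanSpace ℝ (Fin n) × Fin m),
      IsGreatest {M' | Switched.IsWeaklyInvariant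
          (Switched.trajLyapStar f Ω V ∩ Switched.trajCov f χ ∩
            Switched.trajSwitchingBound f κ) M' ∧ M' ⊆ Ω ×ˢ univ} M ∧
      Tendsto (fun t : ℝ ↦ Metric.infDist (p.x t) (Prod.fst '' M)) atTop (𝓝 0) := by
  obtain ⟨x, σ, I⟩ := p
  obtain ⟨⟨hpV, hpχ⟩, hpκ⟩ := hp
  obtain ⟨hσ, hI, hx, -⟩ := hpκ.1
  obtain rfl : I = Ici 0 := hI.subset_Ici.antisymm fun t ht ↦ (hpB t ht).1
  have hxB : ∀ t, 0 ≤ t → x t ∈ B := fun t ht ↦ (hpB t ht).2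
  have hxu := hx.uniformContinuousOn_of_mem_isCompact hf hσ hB hxB
  have hlim (U : Ultrafilter ℝ) (hU : (U : Filter ℝ) ≤ atTop) :
      ∃ y ρ, Switched.IsLimitMotion x σ U y ρ :=
    hpκ.2.exists_isLimitMotion hσ hB ((eventually_ge_atTop 0).mono hxB) hU
  have hF (U y ρ) (h : Switched.IsLimitMotion x σ U y ρ) : ⟨y, ρ, Ici 0⟩ ∈
      Switched.trajLyapStar f Ω V ∩ Switched.trajCov f χ ∩ Switched.trajSwitchingBound f κ := by
    have hy := h.mem_trajSwitchingBound hf hxu hpκ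
    exact ⟨⟨h.mem_trajLyapStar hxu hV hB.isClosed hBΩ hxB hpV hy.1,
      h.mem_trajCov hxu hχ hpχ hy.1⟩, hy⟩
  have hM := Switched.isWeaklyInvariant_limitMotionStates
    (Switched.limitMotionStates_nonempty hlim) hF
  have hMΩ : Switched.limitMotionStates x σ ⊆ Ω ×ˢ univ := by
    rintro _ ⟨U, y, ρ, h, rfl⟩
    exact ⟨(hF U y ρ h).1.1.1.2.1 0 self_mem_Ici, mem_univ _⟩
  have hgreatest := Switched.isGreatest_sUnion_isWeaklyInvariant ⟨_, hM, hMΩ⟩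
  exact ⟨_, hgreatest, Switched.tendsto_infDist_of_limitMotionStates_subset hlim
    (hgreatest.2 ⟨hM, hMΩ⟩)⟩

theorem theorem4 {n m : ℕ}
    (f : Fin m → EuclideanSpace ℝ (Fin n) → EuclideanSpace ℝ (Fin n))
    (hf : ∀ γ, Continuous (f γ))
    (χ : Fin m → Set (EuclideanSpace ℝ (Fin n))) (hχ : Switched.IsClosedCovering χ)
    (Ω : Set (EuclideanSpace ℝ (Fin n))) (hΩ : IsOpen Ω)
    (V : EuclideanSpace ℝ (Fin n) × Fin m → ℝ) (hV : ContinuousOn V (Ω ×ˢ univ))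
    (τD : ℝ) (hτD : 0 < τD) (N0 : ℕ)
    (p : Switched.Pair n m)
    (hp : p ∈ Switched.trajLyap f Ω V ∩ Switched.trajCov f χ ∩ Switched.trajDwell f τD N0)
    (B : Set (EuclideanSpace ℝ (Fin n))) (hB : IsCompact B) (hBΩ : B ⊆ Ω)
    (hpB : ∀ t, 0 ≤ t → t ∈ p.dom ∧ p.x t ∈ B) :
    ∃ M : Set (EuclideanSpace ℝ (Fin n) × Fin m),
      IsGreatest {M' | Switched.IsWeaklyInvariant
          (Switched.trajLyapStar f Ω V ∩ Switched.trajCov f χ ∩ Switched.trajDwell f τD N0) M' ∧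
          M' ⊆ Ω ×ˢ univ} M ∧
      Tendsto (fun t : ℝ => Metric.infDist (p.x t) (Prod.fst '' M)) atTop (𝓝 0) :=
  theorem4_general f hf χ hχ.isClosed Ω V hV (fun ℓ ↦ N0 + ℓ / τD) p hp B hB hBΩ hpB
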